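/- Let $\mathcal{E}$ be an elementary topos, i.e. a category with finite limits and finite colimits, exponentials and a subobject classifier. Call an object $X$ of $\mathcal{E}$ \emph{decidable} if its diagonal $X \to X \times X$ is a complemented subobject, i.e. a coproduct injection; let $\mathrm{dec}(\mathcal{E})$ be the full subcategory of decidable objects, and let $2 = 1 + 1$. Suppose that (NS) every object of $\mathcal{E}$ is initial or has a global element; and (DQO) for every object $X$ there is an epimorphism $q : X \to Q$ with $Q$ decidable such that every arrow $X \to 2$ factors uniquely through $q$, and $q$ is unique with these properties up to an isomorphism under $X$. For every object $X$ let $p_X : X \to \Pi X$ be a quotient as in (DQO). Then $X \mapsto \Pi X$ is the object part of a functor $\Pi : \mathcal{E} \to \mathrm{dec}(\mathcal{E})$ which is left adjoint to the inclusion $\mathrm{dec}(\mathcal{E}) \hookrightarrow \mathcal{E}$, with unit $p$, and which preserves finite products. -/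

import Mathlib

open CategoryTheory CategoryTheory.Limits MonoidalCategory CartesianMonoidalCategory

universe v u

namespace DecTopos

/-- A map `a : A ⟶ X` is a complemented subobject if there is `b : B ⟶ X` such that `a` and `b`
are the injections of a coproduct `X = A + B`. (In a topos coproduct injections are monic.) -/
def IsComplemented {C : Type u} [Category.{v} C] {A X : C} (a : A ⟶ X) : Prop :=
  ∃ (B : C) (b : B ⟶ X), Nonempty (IsColimit (BinaryCofan.mk a b))

/-- An object is decidable if its diagonal `X ⟶ X × X` is complemented. -/
def IsDecidable (C : Type u) [Category.{v} C] [CartesianMonoidalCategory C] :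
    ObjectProperty C :=
  fun X => IsComplemented (lift (𝟙 X) (𝟙 X) : X ⟶ X ⊗ X)

/-- The category `dec(E)`: the full subcategory of decidable objects. -/
abbrev Dec (C : Type u) [Category.{v} C] [CartesianMonoidalCategory C] :=
  (IsDecidable C).FullSubcategory

/-- The inclusion of the decidable objects. -/
abbrev decInclusion (C : Type u) [Category.{v} C] [CartesianMonoidalCategory C] :
    Dec C ⥤ C :=
  (IsDecidable C).ι

/-- The object `2 = 1 + 1`. -/
noncomputable abbrev two (C : Type u) [Category.{v} C] [CartesianMonoidalCategory C]
    [HasFiniteColimits C] : C :=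
  𝟙_ C ⨿ 𝟙_ C

/-- NS: every object is initial or has a global element. -/
def NS (C : Type u) [Category.{v} C] [CartesianMonoidalCategory C] : Prop :=
  ∀ X : C, Nonempty (IsInitial X) ∨ Nonempty (𝟙_ C ⟶ X)

/-- `q : X ⟶ Q` is a decidable quotient of `X` along which every arrow `X ⟶ 2` factors
uniquely. -/
structure IsDecQuotient {C : Type u} [Category.{v} C] [CartesianMonoidalCategory C]
    [HasFiniteColimits C] {X Q : C} (q : X ⟶ Q) : Prop where
  epi : Epi q
  decidable : IsDecidable C Q
  factors : ∀ f : X ⟶ two C, ∃! g : Q ⟶ two C, q ≫ g = f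

/-- DQO: every object `X` has a decidable quotient along which every arrow `X ⟶ 2` factors
uniquely, and this quotient is unique (as a quotient of `X`, that is, up to an isomorphism
under `X`). -/
def DQO (C : Type u) [Category.{v} C] [CartesianMonoidalCategory C]
    [HasFiniteColimits C] : Prop :=
  ∀ X : C,
    (∃ (Q : C) (q : X ⟶ Q), IsDecQuotient q) ∧
    ∀ (Q Q' : C) (q : X ⟶ Q) (q' : X ⟶ Q'), IsDecQuotient q → IsDecQuotient q' →
      ∃ e : Q ≅ Q', q ≫ e.hom = q'

end DecTopos

namespace DecTopos

/-! Under NS, points of `K` and maps `D ⟶ 2` separate maps `f, g : K ⟶ D` into a decidable `D`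
(`IsDecidable.hom_ext`). Pull the complement of the diagonal back along `(f, g)`. If the result is
initial, then `f = g`. If it has a point `k`, equality with `f k` is a map `D ⟶ 2` that tells `f k`
from `g k`, unless the topos is degenerate. Since maps `X ⟶ 2` factor through a decidable quotient
`q`, every map from `X` to a decidable object identifies what `q` identifies. Epimorphisms in a
topos are effective, so it factors through `q`: this is the reflection. For products, the same
argument is run one variable at a time, the other being frozen at a point. The topos facts about
covers all come from universal quantification along a map (`exists_forall_along`). -/

lemma exists_desc_of_isColimit {C : Type u} [Category.{v} C] {A B X Z : C} {a : A ⟶ X} {b : B ⟶ X}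
    (c : IsColimit (BinaryCofan.mk a b)) (f : A ⟶ Z) (g : B ⟶ Z) :
    ∃ d : X ⟶ Z, a ≫ d = f ∧ b ≫ d = g :=
  let ⟨d, h1, h2⟩ := BinaryCofan.IsColimit.desc' c f g
  ⟨d, h1, h2⟩

lemma hom_ext_of_isColimit_binaryCofan {C : Type u} [Category.{v} C] {A B X Z : C} {a : A ⟶ X}
    {b : B ⟶ X} (c : IsColimit (BinaryCofan.mk a b)) {f g : X ⟶ Z} (h1 : a ≫ f = a ≫ g)
    (h2 : b ≫ f = b ≫ g) : f = g :=
  BinaryCofan.IsColimit.hom_ext c h1 h2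

/-! ### Universal quantification, and stability of covers under base change. -/

section Covers

variable {E : Type u} [Category.{v} E] [HasSubobjectClassifier E]

/-- Membership in a subobject is detected by its characteristic map. -/
lemma comp_χ_eq_truth_iff {U X W : E} (m : U ⟶ X) [Mono m] (w : W ⟶ X) :
    w ≫ HasSubobjectClassifier.χ m =
        Subobject.Classifier.χ₀ _ W ≫ HasSubobjectClassifier.truth E ↔
      ∃ s : W ⟶ U, s ≫ m = w := by
  have hm := HasSubobjectClassifier.isPullback_χ m
  constructor
  · intro h
    exact ⟨hm.lift _ _ h, hm.lift_fst _ _ h⟩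
  · rintro ⟨s, rfl⟩
    rw [Category.assoc, hm.w, ← Category.assoc]
    congr 1
    exact Subsingleton.elim _ _

variable [HasFiniteLimits E]

/-- Characteristic maps are equal if they classify the same generalized elements. -/
lemma classifier_hom_ext {X : E} {φ ψ : X ⟶ HasSubobjectClassifier.Ω E}
    (h : ∀ {W : E} (w : W ⟶ X),
      w ≫ φ = Subobject.Classifier.χ₀ _ W ≫ HasSubobjectClassifier.truth E ↔
        w ≫ ψ = Subobject.Classifier.χ₀ _ W ≫ HasSubobjectClassifier.truth E) : φ = ψ := by
  -- Both maps classify the same subobject, the pullback of `truth` along `φ`.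
  have key : ∀ θ : X ⟶ HasSubobjectClassifier.Ω E,
      (∀ {W : E} (w : W ⟶ X),
        w ≫ φ = Subobject.Classifier.χ₀ _ W ≫ HasSubobjectClassifier.truth E ↔
          w ≫ θ = Subobject.Classifier.χ₀ _ W ≫ HasSubobjectClassifier.truth E) →
      θ = HasSubobjectClassifier.χ (pullback.fst φ (HasSubobjectClassifier.truth E)) := by
    intro θ hθ
    apply HasSubobjectClassifier.unique
    have hw : pullback.fst φ (HasSubobjectClassifier.truth E) ≫ φ =
        Subobject.Classifier.χ₀ _ _ ≫ HasSubobjectClassifier.truth E := by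
      rw [pullback.condition]
      congr 1
      exact Subsingleton.elim _ _
    refine ⟨⟨(hθ _).1 hw⟩, ⟨PullbackCone.IsLimit.mk _
      (fun s => pullback.lift s.fst s.snd ?_) ?_ ?_ ?_⟩⟩
    · have h0 : s.snd = Subobject.Classifier.χ₀ _ _ := Subsingleton.elim _ _
      have := (hθ s.fst).2 (by rw [s.condition, h0])
      rw [this, h0]
    · intro s
      exact pullback.lift_fst _ _ _
    · intro s
      exact Subsingleton.elim _ _
    · intro s m h1 _
      rw [← cancel_mono (pullback.fst φ (HasSubobjectClassifier.truth E)), h1]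
      exact (pullback.lift_fst _ _ _).symm
  rw [key φ (fun _ => Iff.rfl), ← key ψ h]

variable [CartesianMonoidalCategory E] [MonoidalClosed E]

/-- Universal quantification along `f`, together with its stability under base change, in terms of
generalized elements. -/
lemma exists_forall_along {Y Z U : E} (f : Y ⟶ Z) (m : U ⟶ Y) [Mono m] :
    ∃ (V : E) (v : V ⟶ Z), Mono v ∧ ∀ {T : E} (t : T ⟶ Z),
      (∃ s : T ⟶ V, s ≫ v = t) ↔
        ∀ {W : E} (y : W ⟶ Y) (z : W ⟶ T), y ≫ f = z ≫ t → ∃ s : W ⟶ U, s ≫ m = y := by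
  have hG : Mono (lift (𝟙 Y) f) := ⟨fun a b h => by simpa using h =≫ fst _ _⟩
  have hG' : Mono (lift m (m ≫ f)) :=
    ⟨fun a b h => by simpa [cancel_mono] using h =≫ fst _ _⟩
  -- Curried, `φ` sends `z` to the fibre of `f` over `z`, and `ψ` sends it to the part of that fibre
  -- in `U`. They agree exactly where the fibre lies in `U`.
  let φ := HasSubobjectClassifier.χ (lift (𝟙 Y) f)
  let ψ := HasSubobjectClassifier.χ (lift m (m ≫ f))
  refine ⟨equalizer (MonoidalClosed.curry φ) (MonoidalClosed.curry ψ), equalizer.ι _ _,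
    inferInstance, ?_⟩
  intro T t
  have h1 : (∃ s : T ⟶ equalizer (MonoidalClosed.curry φ) (MonoidalClosed.curry ψ),
      s ≫ equalizer.ι _ _ = t) ↔ Y ◁ t ≫ φ = Y ◁ t ≫ ψ := by
    rw [← (MonoidalClosed.curry_injective (A := Y)).eq_iff, MonoidalClosed.curry_natural_left,
      MonoidalClosed.curry_natural_left]
    constructor
    · rintro ⟨s, rfl⟩
      rw [Category.assoc, Category.assoc, equalizer.condition]
    · intro h
      exact ⟨equalizer.lift t h, equalizer.lift_ι _ _⟩
  have hφ : ∀ {W : E} (w : W ⟶ Y ⊗ T), w ≫ Y ◁ t ≫ φ =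
      Subobject.Classifier.χ₀ _ W ≫ HasSubobjectClassifier.truth E ↔
        (w ≫ fst _ _) ≫ f = (w ≫ snd _ _) ≫ t := by
    intro W w
    rw [← Category.assoc, comp_χ_eq_truth_iff]
    constructor
    · rintro ⟨s, hs⟩
      have e1 := hs =≫ fst _ _
      have e2 := hs =≫ snd _ _
      simp only [Category.assoc, lift_fst, lift_snd, whiskerLeft_fst, whiskerLeft_snd,
        Category.comp_id] at e1 e2
      rw [← e1, e2, Category.assoc]
    · intro h
      refine ⟨w ≫ fst _ _, CartesianMonoidalCategory.hom_ext _ _ ?_ ?_⟩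
      · simp
      · simpa using h
  have hψ : ∀ {W : E} (w : W ⟶ Y ⊗ T), w ≫ Y ◁ t ≫ ψ =
      Subobject.Classifier.χ₀ _ W ≫ HasSubobjectClassifier.truth E ↔
        (w ≫ fst _ _) ≫ f = (w ≫ snd _ _) ≫ t ∧ ∃ s : W ⟶ U, s ≫ m = w ≫ fst _ _ := by
    intro W w
    rw [← Category.assoc, comp_χ_eq_truth_iff]
    constructor
    · rintro ⟨s, hs⟩
      have e1 := hs =≫ fst _ _
      have e2 := hs =≫ snd _ _
      simp only [Category.assoc, lift_fst, lift_snd, whiskerLeft_fst, whiskerLeft_snd] at e1 e2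
      refine ⟨?_, s, e1⟩
      rw [← e1, Category.assoc, Category.assoc, e2]
    · rintro ⟨h, s, hs⟩
      refine ⟨s, CartesianMonoidalCategory.hom_ext _ _ ?_ ?_⟩
      · simpa using hs
      · simp only [Category.assoc, lift_snd, whiskerLeft_snd]
        rw [← Category.assoc, hs, h, Category.assoc]
  rw [h1]
  constructor
  · intro h W y z hyz
    have h2 := (hφ (lift y z)).2 (by simpa using hyz)
    rw [h, hψ] at h2
    simpa using h2.2
  · intro h
    apply classifier_hom_ext
    intro W w
    rw [hφ, hψ]
    exact ⟨fun e => ⟨e, h _ _ e⟩, fun e => e.1⟩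

/-- If the arrows in `S` do not factor through a proper subobject of `X`, then their pullbacks along
any `h : K ⟶ X` are jointly epimorphic. -/
lemma hom_ext_of_cover {X K Z : E} (S : Presieve X)
    (hS : ∀ {V : E} (v : V ⟶ X), Mono v →
      (∀ {W : E} (w : W ⟶ X), S w → ∃ s : W ⟶ V, s ≫ v = w) → ∃ s : X ⟶ V, s ≫ v = 𝟙 X)
    (h : K ⟶ X) {f g : K ⟶ Z}
    (H : ∀ {W U : E} (y : W ⟶ K) (w : U ⟶ X) (z : W ⟶ U), S w → y ≫ h = z ≫ w →
      y ≫ f = y ≫ g) : f = g := by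
  -- `V` consists of the points of `X` over whose fibre `f` and `g` agree. It contains every arrow
  -- of `S`, so it is all of `X`.
  obtain ⟨V, v, hv, hV⟩ := exists_forall_along h (equalizer.ι f g)
  obtain ⟨s, hs⟩ := hS v hv (fun {U} w hw => (hV w).2 (fun y z e =>
    ⟨equalizer.lift y (H y w z hw e), equalizer.lift_ι _ _⟩))
  obtain ⟨r, hr⟩ := (hV h).1 ⟨h ≫ s, by rw [Category.assoc, hs, Category.comp_id]⟩
    (𝟙 K) (𝟙 K) rfl
  rw [← Category.id_comp f, ← Category.id_comp g, ← hr, Category.assoc, Category.assoc,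
    equalizer.condition]

/-- Epimorphisms are stable under pullback. -/
lemma hom_ext_of_epi {X Q K Z : E} (q : X ⟶ Q) [Epi q] (h : K ⟶ Q) {f g : K ⟶ Z}
    (H : ∀ {W : E} (y : W ⟶ K) (x : W ⟶ X), y ≫ h = x ≫ q → y ≫ f = y ≫ g) : f = g := by
  refine hom_ext_of_cover (Presieve.singleton q) ?_ h ?_
  · intro V v hv hq
    obtain ⟨s, hs⟩ := hq q (Presieve.singleton_self q)
    have : Epi v := epi_of_epi_fac hs
    have : IsIso v := isIso_of_mono_of_epi v
    exact ⟨inv v, by simp⟩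
  · rintro W U y w z ⟨⟩ e
    exact H y z e

/-- The injections of a coproduct stay jointly epimorphic under pullback. -/
lemma hom_ext_of_isColimit {A B X K Z : E} {a : A ⟶ X} {b : B ⟶ X}
    (c : IsColimit (BinaryCofan.mk a b)) (h : K ⟶ X) {f g : K ⟶ Z}
    (Ha : ∀ {W : E} (y : W ⟶ K) (x : W ⟶ A), y ≫ h = x ≫ a → y ≫ f = y ≫ g)
    (Hb : ∀ {W : E} (y : W ⟶ K) (x : W ⟶ B), y ≫ h = x ≫ b → y ≫ f = y ≫ g) : f = g := by
  refine hom_ext_of_cover (fun W w => (∃ s : W ⟶ A, s ≫ a = w) ∨ ∃ s : W ⟶ B, s ≫ b = w) ?_ h ?_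
  · intro V v _ hv
    obtain ⟨s, hs⟩ := hv a (Or.inl ⟨𝟙 _, Category.id_comp _⟩)
    obtain ⟨t, ht⟩ := hv b (Or.inr ⟨𝟙 _, Category.id_comp _⟩)
    obtain ⟨r, hr1, hr2⟩ := exists_desc_of_isColimit c s t
    exact ⟨r, hom_ext_of_isColimit_binaryCofan c (by rw [reassoc_of% hr1, hs, Category.comp_id])
      (by rw [reassoc_of% hr2, ht, Category.comp_id])⟩
  · rintro W U y w z (⟨s, rfl⟩ | ⟨s, rfl⟩) e
    · exact Ha y (z ≫ s) (by rw [e, Category.assoc])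
    · exact Hb y (z ≫ s) (by rw [e, Category.assoc])

/-- In a topos every epimorphism is the coequalizer of its kernel pair. -/
lemma exists_factor_of_epi {X Q D : E} (q : X ⟶ Q) [Epi q] (f : X ⟶ D)
    (hf : ∀ {W : E} (x x' : W ⟶ X), x ≫ q = x' ≫ q → x ≫ f = x' ≫ f) :
    ∃ g : Q ⟶ D, q ≫ g = f := by
  have hG : Mono (lift (𝟙 X) f) := ⟨fun a b h => by simpa using h =≫ fst _ _⟩
  -- `V` consists of the pairs `(b, d)` such that `f` is constantly `d` on the fibre of `q` over
  -- `b`. It is the graph of the required map: its projection to `Q` is epi because `(q, f)` lands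
  -- in `V`, and mono because `q` is a stable epimorphism.
  obtain ⟨V, v, hv, hV⟩ := exists_forall_along (q ▷ D) (lift (𝟙 X) f)
  obtain ⟨s, hs⟩ := (hV (lift q f)).2 (fun {W} y z e => by
    have e1 := e =≫ fst _ _
    have e2 := e =≫ snd _ _
    simp only [Category.assoc, lift_fst, lift_snd, whiskerRight_fst, whiskerRight_snd] at e1 e2
    refine ⟨y ≫ fst _ _, CartesianMonoidalCategory.hom_ext _ _ ?_ ?_⟩
    · simp
    · rw [e2, ← hf (y ≫ fst _ _) z (by simpa using e1)]
      simp)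
  have hsr : s ≫ v ≫ fst _ _ = q := by rw [← Category.assoc, hs, lift_fst]
  have : Epi (v ≫ fst _ _) := epi_of_epi_fac hsr
  have hmono : Mono (v ≫ fst Q D) := by
    refine ⟨fun {T} a b hab => ?_⟩
    rw [← cancel_mono v]
    refine CartesianMonoidalCategory.hom_ext _ _ (by simpa using hab) ?_
    refine hom_ext_of_epi q (a ≫ v ≫ fst _ _) (fun {W} z x e => ?_)
    have key : ∀ c : T ⟶ V, z ≫ c ≫ v ≫ fst _ _ = x ≫ q → z ≫ (c ≫ v) ≫ snd _ _ = x ≫ f := by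
      intro c hc
      obtain ⟨r, hr⟩ := (hV v).1 ⟨𝟙 _, Category.id_comp _⟩
        (lift x (z ≫ c ≫ v ≫ snd _ _)) (z ≫ c)
        (CartesianMonoidalCategory.hom_ext _ _ (by simpa using hc.symm) (by simp))
      have e1 := hr =≫ fst _ _
      have e2 := hr =≫ snd _ _
      simp only [Category.assoc, lift_fst, lift_snd, Category.comp_id] at e1 e2
      rw [← e1, e2, Category.assoc]
    rw [key a e, key b (by rw [← hab]; exact e)]
  have : IsIso (v ≫ fst Q D) := isIso_of_mono_of_epi _
  refine ⟨inv (v ≫ fst Q D) ≫ v ≫ snd _ _, ?_⟩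
  calc q ≫ inv (v ≫ fst Q D) ≫ v ≫ snd _ _
      = s ≫ (v ≫ fst Q D) ≫ inv (v ≫ fst Q D) ≫ v ≫ snd _ _ := by
        rw [← hsr]; simp only [Category.assoc]
    _ = f := by rw [IsIso.hom_inv_id_assoc, ← Category.assoc, hs, lift_snd]

/-- The map factors as two whiskerings, each a pullback of one of the given epimorphisms. -/
lemma epi_tensorHom {X Y X' Y' : E} (f : X ⟶ X') (g : Y ⟶ Y') [Epi f] [Epi g] :
    Epi (f ⊗ₘ g) := by
  have h1 : Epi (f ▷ Y) := ⟨fun a b hab => hom_ext_of_epi f (fst X' Y) (fun {W} y x e => by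
    have hy : y = lift x (y ≫ snd _ _) ≫ f ▷ Y :=
      CartesianMonoidalCategory.hom_ext _ _ (by simpa using e) (by simp)
    rw [hy, Category.assoc, Category.assoc, hab])⟩
  have h2 : Epi (X' ◁ g) := ⟨fun a b hab => hom_ext_of_epi g (snd X' Y') (fun {W} y x e => by
    have hy : y = lift (y ≫ fst _ _) x ≫ X' ◁ g :=
      CartesianMonoidalCategory.hom_ext _ _ (by simp) (by simpa using e)
    rw [hy, Category.assoc, Category.assoc, hab])⟩
  rw [MonoidalCategory.tensorHom_def]
  exact epi_comp _ _

end Covers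

/-! ### Separation of maps into decidable objects, and the universal property of decidable
quotients. -/

section Decidable

variable {E : Type u} [Category.{v} E] [CartesianMonoidalCategory E] [HasFiniteColimits E]
  [MonoidalClosed E]

/-- If the two points of `2` agree, the category is a preorder. -/
lemma hom_eq_of_inl_eq_inr (h : (coprod.inl : 𝟙_ E ⟶ two E) = coprod.inr) {K Z : E}
    (f g : K ⟶ Z) : f = g := by
  have hp : ∀ {Y : E} (a b : 𝟙_ E ⟶ Y), a = b := fun a b => by
    rw [← coprod.inl_desc a b, h, coprod.inr_desc]
  -- Maps `K ⟶ Z` are points of the internal hom, and any two points of an object agree.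
  exact (MonoidalClosed.curryHomEquiv' (X := K) (Y := Z)).injective (hp _ _)

variable [HasFiniteLimits E] [HasSubobjectClassifier E]

/-- Under NS, maps into a decidable object are separated by points and maps to `2`. -/
lemma IsDecidable.hom_ext (hNS : NS E) {D K : E} (hD : IsDecidable E D) {f g : K ⟶ D}
    (h : ∀ (k : 𝟙_ E ⟶ K) (χ : D ⟶ two E), k ≫ f ≫ χ = k ≫ g ≫ χ) : f = g := by
  obtain ⟨C, b, ⟨c⟩⟩ := hD
  -- `δ` decides equality on `D`: `inl` on the diagonal, `inr` on its complement.
  obtain ⟨δ, hδ1, hδ2⟩ := exists_desc_of_isColimit c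
    (toUnit D ≫ (coprod.inl : 𝟙_ E ⟶ two E)) (toUnit C ≫ (coprod.inr : 𝟙_ E ⟶ two E))
  refine hom_ext_of_isColimit c (lift f g) (fun {W} y x e => ?_) (fun {W} y x e => ?_)
  · have e1 := e =≫ fst _ _
    have e2 := e =≫ snd _ _
    simp only [Category.assoc, lift_fst, lift_snd, Category.comp_id] at e1 e2
    rw [e1, e2]
  -- Here `(f, g)` lands in the complement of the diagonal. At a point of `W`, the test map `δ(d,
  -- -)` takes the value `inl` on `f` and `inr` on `g`.
  · obtain ⟨⟨hW⟩⟩ | ⟨⟨w⟩⟩ := hNS W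
    · exact hW.hom_ext _ _
    · refine hom_eq_of_inl_eq_inr ?_ _ _
      let d : 𝟙_ E ⟶ D := w ≫ y ≫ f
      have hk := h (w ≫ y) (lift (toUnit D ≫ d) (𝟙 D) ≫ δ)
      have h1 : (w ≫ y) ≫ f ≫ lift (toUnit D ≫ d) (𝟙 D) ≫ δ = coprod.inl := by
        have : (w ≫ y) ≫ f ≫ lift (toUnit D ≫ d) (𝟙 D) = d ≫ lift (𝟙 D) (𝟙 D) := by
          apply CartesianMonoidalCategory.hom_ext
          · simp [d, ← Category.assoc, toUnit_unique _ (𝟙 (𝟙_ E))]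
          · simp [d]
        rw [← Category.assoc f, ← Category.assoc (w ≫ y), this, Category.assoc, hδ1,
          ← Category.assoc, toUnit_unique (d ≫ toUnit D) (𝟙 _), Category.id_comp]
      have h2 : (w ≫ y) ≫ g ≫ lift (toUnit D ≫ d) (𝟙 D) ≫ δ = coprod.inr := by
        have : (w ≫ y) ≫ g ≫ lift (toUnit D ≫ d) (𝟙 D) = (w ≫ x) ≫ b := by
          rw [Category.assoc w x, ← e]
          apply CartesianMonoidalCategory.hom_ext
          · simp [d, ← Category.assoc, toUnit_unique _ (𝟙 (𝟙_ E))]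
          · simp [d]
        rw [← Category.assoc g, ← Category.assoc (w ≫ y), this, Category.assoc, hδ2,
          ← Category.assoc, toUnit_unique ((w ≫ x) ≫ toUnit C) (𝟙 _), Category.id_comp]
      rw [← h1, hk, h2]

namespace IsDecQuotient

variable {X Q D : E} {q : X ⟶ Q}

/-- A map to a decidable object identifies what a decidable quotient identifies. -/
lemma comp_eq (hNS : NS E) (hq : IsDecQuotient q) (hD : IsDecidable E D) (f : X ⟶ D)
    {W : E} {x x' : W ⟶ X} (h : x ≫ q = x' ≫ q) : x ≫ f = x' ≫ f := by
  refine IsDecidable.hom_ext hNS hD (fun k χ => ?_)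
  obtain ⟨g, hg, _⟩ := hq.factors (f ≫ χ)
  simp only [Category.assoc]
  rw [← hg, reassoc_of% h]

/-- A decidable quotient is the reflection in the decidable objects. -/
lemma existsUnique_desc (hNS : NS E) (hq : IsDecQuotient q) (hD : IsDecidable E D) (f : X ⟶ D) :
    ∃! g : Q ⟶ D, q ≫ g = f := by
  have := hq.epi
  obtain ⟨g, hg⟩ := exists_factor_of_epi q f (fun x x' h => hq.comp_eq hNS hD f h)
  exact ⟨g, hg, fun g' hg' => by rw [← cancel_epi q, hg, hg']⟩

/-- Maps to decidable objects factor through products of decidable quotients. -/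
lemma exists_tensorHom_desc (hNS : NS E) (hq : IsDecQuotient q) {Y R : E} {r : Y ⟶ R}
    (hr : IsDecQuotient r) (hD : IsDecidable E D) (f : X ⊗ Y ⟶ D) :
    ∃ g : Q ⊗ R ⟶ D, (q ⊗ₘ r) ≫ g = f := by
  have := hq.epi
  have := hr.epi
  have := epi_tensorHom q r
  refine exists_factor_of_epi (q ⊗ₘ r) f (fun {W} a b h => ?_)
  refine IsDecidable.hom_ext hNS hD (fun k χ => ?_)
  have e1 := k ≫= h =≫ fst _ _
  have e2 := k ≫= h =≫ snd _ _
  simp only [Category.assoc, tensorHom_fst, tensorHom_snd] at e1 e2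
  -- At the point `k`, write `a = (a₁, a₂)` and `b = (b₁, b₂)`. Freezing one coordinate at a time
  -- gives `f(a₁, a₂) = f(b₁, a₂) = f(b₁, b₂)`.
  have hx := hq.comp_eq hNS hD (lift (𝟙 X) (toUnit X ≫ k ≫ a ≫ snd _ _) ≫ f)
    (x := k ≫ a ≫ fst _ _) (x' := k ≫ b ≫ fst _ _) (by simpa using e1)
  have hy := hr.comp_eq hNS hD (lift (toUnit Y ≫ k ≫ b ≫ fst _ _) (𝟙 Y) ≫ f)
    (x := k ≫ a ≫ snd _ _) (x' := k ≫ b ≫ snd _ _) (by simpa using e2)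
  simp only [← Category.assoc, comp_lift, toUnit_unique _ (𝟙 (𝟙_ E)), Category.id_comp,
    Category.comp_id] at hx hy
  have ha : lift ((k ≫ a) ≫ fst _ _) ((k ≫ a) ≫ snd _ _) = k ≫ a := lift_comp_fst_snd _
  have hb : lift ((k ≫ b) ≫ fst _ _) ((k ≫ b) ≫ snd _ _) = k ≫ b := lift_comp_fst_snd _
  rw [ha] at hx
  rw [hb] at hy
  simp only [← Category.assoc]
  rw [hx, hy]

/-- A decidable quotient of a product is the product of the decidable quotients. -/
lemma exists_iso_tensor (hNS : NS E) (hq : IsDecQuotient q) {Y R P : E} {r : Y ⟶ R}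
    (hr : IsDecQuotient r) {s : X ⊗ Y ⟶ P} (hs : IsDecQuotient s) (a : P ⟶ Q) (b : P ⟶ R)
    (ha : s ≫ a = fst X Y ≫ q) (hb : s ≫ b = snd X Y ≫ r) :
    ∃ e : P ≅ Q ⊗ R, e.hom = lift a b := by
  have := hq.epi
  have := hr.epi
  have := hs.epi
  have := epi_tensorHom q r
  obtain ⟨g, hg⟩ := hq.exists_tensorHom_desc hNS hr hs.decidable s
  have hc : s ≫ lift a b = q ⊗ₘ r := by
    rw [comp_lift, ha, hb]
    apply CartesianMonoidalCategory.hom_ext <;> simp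
  refine ⟨⟨lift a b, g, ?_, ?_⟩, rfl⟩
  · rw [← cancel_epi s, reassoc_of% hc, hg, Category.comp_id]
  · rw [← cancel_epi (q ⊗ₘ r), reassoc_of% hg, hc, Category.comp_id]

end IsDecQuotient

end Decidable

/-! ### The reflector and its preservation of finite products. -/

section Reflection

variable {E : Type u} [Category.{v} E] [CartesianMonoidalCategory E]
  [HasFiniteLimits E] [HasFiniteColimits E] [MonoidalClosed E] [HasSubobjectClassifier E]
  (hNS : NS E) {Pi : E → E} (p : ∀ X : E, X ⟶ Pi X) (hp : ∀ X : E, IsDecQuotient (p X))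

/-- Precomposition with a decidable quotient, as a bijection. -/
noncomputable def homEquivOfQuotient (X : E) (D : Dec E) :
    ((⟨Pi X, (hp X).decidable⟩ : Dec E) ⟶ D) ≃ (X ⟶ (decInclusion E).obj D) :=
  Equiv.ofBijective (fun g => p X ≫ (decInclusion E).map g) (by
    constructor
    · intro g g' h
      have := (hp X).epi
      exact (decInclusion E).map_injective ((cancel_epi (p X)).1 h)
    · intro f
      obtain ⟨g, hg, _⟩ := (hp X).existsUnique_desc hNS D.property f
      exact ⟨(IsDecidable E).fullyFaithfulι.preimage g, by
        simpa using hg⟩)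

/-- The functor of decidable quotients. -/
noncomputable def piFunctor : E ⥤ Dec E :=
  Adjunction.leftAdjointOfEquiv (G := decInclusion E) (homEquivOfQuotient hNS p hp)
    (fun X Y Y' g h => by simp [homEquivOfQuotient])

/-- The functor of decidable quotients is left adjoint to the inclusion of decidable objects. -/
noncomputable def piAdjunction : piFunctor hNS p hp ⊣ decInclusion E :=
  Adjunction.adjunctionOfEquivLeft _ _

lemma piAdjunction_unit_app (X : E) : (piAdjunction hNS p hp).unit.app X = p X := by
  simp [piAdjunction, homEquivOfQuotient]
  rfl

lemma comp_piFunctor_map {X Y : E} (f : X ⟶ Y) :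
    p X ≫ (decInclusion E).map ((piFunctor hNS p hp).map f) = f ≫ p Y := by
  have := (piAdjunction hNS p hp).unit.naturality f
  rw [piAdjunction_unit_app, piAdjunction_unit_app] at this
  exact this.symm

lemma preservesFiniteProducts_piFunctor : PreservesFiniteProducts (piFunctor hNS p hp) := by
  have h1 : PreservesLimit (Functor.empty.{0} E) (piFunctor hNS p hp) := by
    have := (hp (𝟙_ E)).epi
    -- A map out of the terminal object is mono, and a topos is balanced.
    have : Mono (p (𝟙_ E)) := ⟨fun _ _ _ => toUnit_unique _ _⟩
    have hi : IsIso (p (𝟙_ E)) := isIso_of_mono_of_epi _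
    have ht : IsTerminal ((decInclusion E).obj ((piFunctor hNS p hp).obj (𝟙_ E))) :=
      isTerminalTensorUnit.ofIso (@asIso _ _ _ _ (p (𝟙_ E)) hi)
    exact preservesLimit_of_preserves_limit_cone isTerminalTensorUnit
      ((isLimitMapConeEmptyConeEquiv _ _).symm (IsTerminal.isTerminalOfObj (decInclusion E) _ ht))
  have := preservesLimitsOfShape_pempty_of_preservesTerminal (piFunctor hNS p hp)
  have h2 : ∀ X Y : E, PreservesLimit (pair X Y) (piFunctor hNS p hp) := by
    intro X Y
    obtain ⟨e, he⟩ := (hp X).exists_iso_tensor hNS (hp Y) (hp (X ⊗ Y)) _ _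
      (comp_piFunctor_map hNS p hp (fst X Y)) (comp_piFunctor_map hNS p hp (snd X Y))
    -- The inclusion is fully faithful, so it reflects limits and the product cone may be checked in
    -- `E`.
    refine preservesLimit_of_preserves_limit_cone (tensorProductIsBinaryProduct X Y)
      ((isLimitMapConeBinaryFanEquiv _ _ _).symm
        (isLimitOfReflectsOfMapIsLimit (decInclusion E) _ _ ?_))
    refine IsLimit.ofIsoLimit (tensorProductIsBinaryProduct (Pi X) (Pi Y))
      (BinaryFan.ext e ?_ ?_).symm
    · rw [he]
      exact (lift_fst _ _).symm
    · rw [he]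
      exact (lift_snd _ _).symm
  have : PreservesLimitsOfShape (Discrete WalkingPair) (piFunctor hNS p hp) :=
    ⟨fun {K} => preservesLimit_of_iso_diagram _ (diagramIsoPair K).symm⟩
  exact PreservesFiniteProducts.of_preserves_binary_and_terminal _

end Reflection

end DecTopos

/-- `E` is an elementary topos (finite limits and colimits, exponentials, a subobject
classifier) with NS and DQO, and `p X : X ⟶ Π X` is any choice of the quotients given by DQO.
Then `Π` is the object part of a functor `E ⥤ dec(E)`, left adjoint to the inclusion with
unit `p`, and this functor preserves finite products. -/
theorem theoremA (E : Type u) [Category.{v} E] [CartesianMonoidalCategory E]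
    [HasFiniteLimits E] [HasFiniteColimits E] [MonoidalClosed E] [HasSubobjectClassifier E]
    (hNS : DecTopos.NS E) (hDQO : DecTopos.DQO E)
    (Pi : E → E) (p : ∀ X : E, X ⟶ Pi X) (hp : ∀ X : E, DecTopos.IsDecQuotient (p X)) :
    ∃ (F : E ⥤ DecTopos.Dec E) (hF : ∀ X : E, (F.obj X).obj = Pi X)
      (adj : F ⊣ DecTopos.decInclusion E),
      (∀ X : E, adj.unit.app X ≫ eqToHom (hF X) = p X) ∧
      PreservesFiniteProducts F := by
  refine ⟨DecTopos.piFunctor hNS p hp, fun _ => rfl, DecTopos.piAdjunction hNS p hp, fun X => ?_,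
    DecTopos.preservesFiniteProducts_piFunctor hNS p hp⟩
  rw [DecTopos.piAdjunction_unit_app]
  -- `hF` holds by `rfl`, so the `eqToHom` is an identity.
  exact Category.comp_id _
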